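/- Let $\mathbb{H}$ be the discrete Heisenberg group, i.e. the group of upper triangular integer $3\times 3$ matrices with ones on the diagonal, and let $\mathbb{Z}[\mathbb{H}]$ be its integral group ring. Let $\mathbb{T}=\mathbb{R}/\mathbb{Z}$, and for $t\in\mathbb{T}$ let $|t|$ denote the distance from $t$ to $0$. For $f=\sum_\gamma f_\gamma\cdot\gamma\in\mathbb{Z}[\mathbb{H}]$ put $$X_f=\Bigl\{x\in\mathbb{T}^{\mathbb{H}} : \sum_{\gamma\in\mathbb{H}} f_\gamma\, x_{\delta\gamma}=0 \text{ for every } \delta\in\mathbb{H}\Bigr\}.$$ **Theorem 5.2.** Let $f$ be an irreducible element of $\mathbb{Z}[\mathbb{H}]$ which has a formal inverse $f^\sharp\in\mathbb{R}^{\mathbb{H}}$, i.e. the convolution products satisfy $f\cdot f^\sharp=f^\sharp\cdot f=1$. Suppose that there is a central element $g$ of $\mathbb{Z}[\mathbb{H}]$ with $g\notin\mathbb{Z}[\mathbb{H}]f$ and $f^\sharp\cdot g\in\ell^1(\mathbb{H},\mathbb{R})$. Then for every $\varepsilon>0$ there is a nonempty finite set $F_\varepsilon\subset\mathbb{H}$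 with the following property: if $F_1,F_2$ are (arbitrary) subsets of $\mathbb{H}$ with $$F_1F_\varepsilon\cap F_2F_\varepsilon=\varnothing ,$$ then for every pair of points $x^1,x^2\in X_f$ there is a point $y\in X_f$ with $$|x^j_\gamma-y_\gamma|<\varepsilon\quad\text{for every }\gamma\in F_j,\ j=1,2 .$$ -/

import Mathlib

open scoped Pointwise

/-- The discrete Heisenberg group: the subgroup of `SL(3, ℤ)` consisting of the upper
triangular matrices with ones on the diagonal. -/
def heisenberg : Subgroup (Matrix.SpecialLinearGroup (Fin 3) ℤ) where
  carrier := {M | M.1 0 0 = 1 ∧ M.1 1 1 = 1 ∧ M.1 2 2 = 1 ∧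
    M.1 1 0 = 0 ∧ M.1 2 0 = 0 ∧ M.1 2 1 = 0}
  mul_mem' := by
    rintro M N ⟨h1, h2, h3, h4, h5, h6⟩ ⟨k1, k2, k3, k4, k5, k6⟩
    simp [Matrix.mul_apply, Fin.sum_univ_three, *]
  one_mem' := by simp
  inv_mem' := by
    rintro M ⟨h1, h2, h3, h4, h5, h6⟩
    simp [Matrix.SpecialLinearGroup.coe_inv, Matrix.adjugate_fin_three, *]

namespace PrincipalAction

variable {Γ : Type*} [Group Γ]

/-- The right shift `(ρ^γ x)_δ = x_{δγ}` on `𝕋^Γ`, where `𝕋 = ℝ / ℤ`. -/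
def rho (γ : Γ) : (Γ → UnitAddCircle) →+ (Γ → UnitAddCircle) where
  toFun x := fun δ => x (δ * γ)
  map_zero' := rfl
  map_add' _ _ := rfl

/-- `ρ^f = ∑_γ f_γ ρ^γ` for `f ∈ ℤ[Γ]`. -/
noncomputable def rhoRing (f : MonoidAlgebra ℤ Γ) :
    (Γ → UnitAddCircle) →+ (Γ → UnitAddCircle) :=
  f.coeff.sum fun γ n => n • rho γ

/-- The group `X_f = ker ρ^f ⊆ 𝕋^Γ`. -/
noncomputable def X (f : MonoidAlgebra ℤ Γ) : AddSubgroup (Γ → UnitAddCircle) :=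
  (rhoRing f).ker

/-- The convolution `f · v`, where `f ∈ ℤ[Γ]` and `v ∈ ℝ^Γ`:
`(f · v)_δ = ∑_γ f_γ v_{γ⁻¹δ}`. -/
noncomputable def mulFun (f : MonoidAlgebra ℤ Γ) (v : Γ → ℝ) : Γ → ℝ :=
  fun δ => f.coeff.sum fun γ n => (n : ℝ) * v (γ⁻¹ * δ)

/-- The convolution `v · f`, where `v ∈ ℝ^Γ` and `f ∈ ℤ[Γ]`:
`(v · f)_δ = ∑_γ v_{δγ⁻¹} f_γ`. -/
noncomputable def funMul (v : Γ → ℝ) (f : MonoidAlgebra ℤ Γ) : Γ → ℝ :=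
  fun δ => f.coeff.sum fun γ n => v (δ * γ⁻¹) * (n : ℝ)

open Classical in
/-- `s ∈ ℝ^Γ` is a formal inverse of `f ∈ ℤ[Γ]`: `f · s = s · f = 1`, where `1` is the
function that is `1` at the identity of `Γ` and `0` elsewhere. -/
def IsFormalInverse (f : MonoidAlgebra ℤ Γ) (s : Γ → ℝ) : Prop :=
  mulFun f s = Pi.single 1 1 ∧ funMul s f = Pi.single 1 1

end PrincipalAction

/-! ### Convolution and correlation on a group -/

namespace PrincipalAction

variable {Γ : Type*} [Group Γ]

/-! Put `w = f^♯ · g`, which is summable and satisfies `f · w = w · f = g`. Lifting `x ∈ X f` to a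
bounded real `v` makes `ρ^f v` a bounded integer configuration `h`, and `w ⋆ h` reduces to `ρ^g x`;
conversely `w ⋆ h` lies in `X f` for every bounded integer `h`. If `ρ^g` maps `X f` onto itself, all
points are thus coded by integer configurations under one bound. Codes, unlike points, can be
spliced freely, and the tail of `w` controls the error (`exists_specification`).

By duality, surjectivity of `ρ^g` follows from injectivity of multiplication by `g` on `ℤ[ℍ]/ℤ[ℍ]f`
(`exists_rhoRing_eq`). A central `g` is a Laurent polynomial in the central generator `z`, so its
primes can be removed one at a time: each is completely prime in `ℤ[ℍ]`, and one that divides the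
irreducible `f` would force `g ∈ ℤ[ℍ]f` (`mem_span_of_mul_ofLaurent_mem`). -/

theorem rhoRing_apply (f : MonoidAlgebra ℤ Γ) (x : Γ → UnitAddCircle) (δ : Γ) :
    rhoRing f x δ = f.coeff.sum fun γ n => n • x (δ * γ) := by
  unfold rhoRing Finsupp.sum
  rw [AddMonoidHom.finsetSum_apply, Finset.sum_apply]
  rfl

/-- The real-valued analogue of `rhoRing`. -/
noncomputable def rhoReal (f : MonoidAlgebra ℤ Γ) (v : Γ → ℝ) : Γ → ℝ :=
  fun δ => f.coeff.sum fun γ n => (n : ℝ) * v (δ * γ)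

theorem coe_rhoReal (f : MonoidAlgebra ℤ Γ) (v : Γ → ℝ) (δ : Γ) :
    ((rhoReal f v δ : ℝ) : UnitAddCircle) =
      rhoRing f (fun γ => (v γ : UnitAddCircle)) δ := by
  rw [rhoRing_apply, rhoReal, Finsupp.sum, Finsupp.sum]
  refine (map_sum (QuotientAddGroup.mk' (AddSubgroup.zmultiples (1 : ℝ))) _ _).trans
    (Finset.sum_congr rfl fun γ _ => ?_)
  change (((f.coeff γ : ℝ) * v (δ * γ) : ℝ) : UnitAddCircle) = _
  rw [← zsmul_eq_mul, AddCircle.coe_zsmul]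

theorem abs_rhoReal_le (f : MonoidAlgebra ℤ Γ) {v : Γ → ℝ} (hv : ∀ γ, |v γ| ≤ 1) (δ : Γ) :
    |rhoReal f v δ| ≤ f.coeff.sum fun _ n => |(n : ℝ)| := by
  refine (Finset.abs_sum_le_sum_abs _ _).trans (Finset.sum_le_sum fun γ _ => ?_)
  rw [abs_mul]
  exact mul_le_of_le_one_right (abs_nonneg _) (hv _)

theorem mulFun_funMul (f g : MonoidAlgebra ℤ Γ) (s : Γ → ℝ) :
    mulFun f (funMul s g) = funMul (mulFun f s) g := by
  funext δ
  simp only [mulFun, funMul, Finsupp.sum, Finset.mul_sum, Finset.sum_mul]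
  rw [Finset.sum_comm]
  simp only [mul_assoc]

theorem funMul_funMul (f g : MonoidAlgebra ℤ Γ) (s : Γ → ℝ) :
    funMul (funMul s f) g = funMul s (f * g) := by
  classical
  funext δ
  have hadd : ∀ a b : MonoidAlgebra ℤ Γ, funMul s (a + b) δ = funMul s a δ + funMul s b δ := by
    intro a b
    simp only [funMul, MonoidAlgebra.coeff_add]
    exact Finsupp.sum_add_index' (by simp) (by intros; push_cast; ring)
  let F : MonoidAlgebra ℤ Γ →+ ℝ :=
    { toFun := fun a => funMul s a δ
      map_zero' := by simp [funMul]
      map_add' := hadd }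
  have hF : F (f * g) = g.coeff.sum fun η m => f.coeff.sum fun γ n =>
      F (MonoidAlgebra.single (γ * η) (n * m)) := by
    rw [MonoidAlgebra.mul_def]
    simp only [Finsupp.sum, map_sum]
    rw [Finset.sum_comm]
  have hsingle : ∀ γ n, F (MonoidAlgebra.single γ n) = s (δ * γ⁻¹) * (n : ℝ) := fun γ n =>
    Finsupp.sum_single_index (h := fun γ (n : ℤ) => s (δ * γ⁻¹) * (n : ℝ)) (by simp)
  change _ = F (f * g)
  rw [hF]
  simp only [hsingle, funMul, Finsupp.sum, Finset.sum_mul]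
  refine Finset.sum_congr rfl fun η _ => Finset.sum_congr rfl fun γ _ => ?_
  push_cast
  rw [mul_inv_rev, mul_assoc δ, mul_assoc]

open Classical in
theorem funMul_single_one (g : MonoidAlgebra ℤ Γ) :
    funMul (Pi.single 1 1) g = fun δ => (g.coeff δ : ℝ) := by
  funext δ
  rw [funMul, Finsupp.sum, Finset.sum_eq_single δ]
  · simp
  · intro γ _ h
    rw [Pi.single_eq_of_ne, zero_mul]
    rwa [Ne, mul_inv_eq_one, eq_comm]
  · simp +contextual

/-- `(w ⋆ v)_δ = ∑_γ w_γ v_{δγ}`. -/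
noncomputable def corr (w v : Γ → ℝ) : Γ → ℝ := fun δ => ∑' γ, w γ * v (δ * γ)

omit [Group Γ] in
theorem summable_mul_of_bounded {w v : Γ → ℝ} (hw : Summable fun γ => |w γ|) {C : ℝ}
    (hv : ∀ γ, |v γ| ≤ C) : Summable fun γ => w γ * v γ := by
  refine Summable.of_norm_bounded (hw.mul_right C) fun γ => ?_
  rw [Real.norm_eq_abs, abs_mul]
  exact mul_le_mul_of_nonneg_left (hv _) (abs_nonneg _)

omit [Group Γ] in
theorem summable_abs_comp {w : Γ → ℝ} (hw : Summable fun γ => |w γ|) (e : Γ ≃ Γ) :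
    Summable fun γ => |w (e γ)| := e.summable_iff.2 hw

/-- As `corr w` plays the role of `ρ^w`, this is `ρ^f ρ^w = ρ^{f·w}`; summability against a bounded
`v` justifies exchanging the sums. -/
theorem rhoReal_corr (f : MonoidAlgebra ℤ Γ) {w v : Γ → ℝ} (hw : Summable fun γ => |w γ|) {C : ℝ}
    (hv : ∀ γ, |v γ| ≤ C) : rhoReal f (corr w v) = corr (mulFun f w) v := by
  funext δ
  simp only [rhoReal, corr, mulFun, Finsupp.sum, Finset.sum_mul]
  rw [Summable.tsum_finsetSum]
  · refine Finset.sum_congr rfl fun η _ => ?_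
    simp only [mul_assoc (f.coeff η : ℝ)]
    rw [tsum_mul_left, ← (Equiv.mulLeft η).tsum_eq fun κ => w (η⁻¹ * κ) * v (δ * κ)]
    simp [mul_assoc]
  · intro η _
    simp only [mul_assoc]
    exact (summable_mul_of_bounded (w := fun κ => w (η⁻¹ * κ)) (v := fun κ => v (δ * κ))
      (summable_abs_comp hw (Equiv.mulLeft η⁻¹)) fun κ => hv _).mul_left _

theorem corr_rhoReal (f : MonoidAlgebra ℤ Γ) {w v : Γ → ℝ} (hw : Summable fun γ => |w γ|) {C : ℝ}
    (hv : ∀ γ, |v γ| ≤ C) : corr w (rhoReal f v) = corr (funMul w f) v := by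
  funext δ
  simp only [rhoReal, corr, funMul, Finsupp.sum, Finset.mul_sum, Finset.sum_mul]
  rw [Summable.tsum_finsetSum, Summable.tsum_finsetSum]
  · refine Finset.sum_congr rfl fun η _ => ?_
    rw [← (Equiv.mulRight η).tsum_eq fun κ => w (κ * η⁻¹) * (f.coeff η : ℝ) * v (δ * κ)]
    simp [mul_assoc]
  · intro η _
    simp only [mul_right_comm]
    exact (summable_mul_of_bounded (w := fun κ => w (κ * η⁻¹)) (v := fun κ => v (δ * κ))
      (summable_abs_comp hw (Equiv.mulRight η⁻¹)) fun κ => hv _).mul_right _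
  · intro η _
    simp only [mul_left_comm (w _)]
    exact (summable_mul_of_bounded (w := w) (v := fun κ => v (δ * κ * η)) hw fun κ => hv _).mul_left _

theorem corr_coeff (g : MonoidAlgebra ℤ Γ) (v : Γ → ℝ) :
    corr (fun δ => (g.coeff δ : ℝ)) v = rhoReal g v := by
  funext δ
  rw [corr, tsum_eq_sum (s := g.coeff.support)]
  · rfl
  · intro γ h
    simp [Finsupp.notMem_support_iff.1 h]

/-! ### Duality and surjectivity of `ρ^g` -/

/-- The `ℤ`-linear extension of `x : Γ → 𝕋` to a character of `ℤ[Γ]`. -/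
noncomputable def pairing (x : Γ → UnitAddCircle) : MonoidAlgebra ℤ Γ →+ UnitAddCircle where
  toFun a := a.coeff.sum fun γ n => n • x γ
  map_zero' := by simp
  map_add' a b := Finsupp.sum_add_index' (by simp) (by intros; rw [add_smul])

omit [Group Γ] in
theorem pairing_single (x : Γ → UnitAddCircle) (γ : Γ) (n : ℤ) :
    pairing x (MonoidAlgebra.single γ n) = n • x γ :=
  Finsupp.sum_single_index (h := fun γ (n : ℤ) => n • x γ) (by simp)

theorem pairing_single_mul (x : Γ → UnitAddCircle) (δ : Γ) (n : ℤ) (f : MonoidAlgebra ℤ Γ) :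
    pairing x (MonoidAlgebra.single δ n * f) = n • rhoRing f x δ := by
  rw [rhoRing_apply]
  conv_lhs => rw [← MonoidAlgebra.sum_coeff_single f]
  simp only [Finsupp.sum, Finset.mul_sum, map_sum, MonoidAlgebra.single_mul_single,
    pairing_single, Finset.smul_sum, mul_smul]

theorem pairing_mul_eq_zero {f : MonoidAlgebra ℤ Γ} {x : Γ → UnitAddCircle} (hx : x ∈ X f)
    (a : MonoidAlgebra ℤ Γ) : pairing x (a * f) = 0 := by
  induction a using MonoidAlgebra.induction_linear with
  | zero => simp
  | add a b ha hb => rw [add_mul, map_add, ha, hb, add_zero]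
  | single γ n =>
    rw [pairing_single_mul, show rhoRing f x = 0 from hx]
    simp

/-- `X f` is the character group of `ℤ[Γ]/ℤ[Γ]f`, and `ρ^g` is dual to right multiplication by `g`.
A character extends along an injection because `𝕋` is divisible. -/
theorem exists_rhoRing_eq {f g : MonoidAlgebra ℤ Γ}
    (hg : ∀ a, Commute g a)
    (hinj : ∀ a, a * g ∈ Ideal.span {f} → a ∈ Ideal.span {f})
    {y : Γ → UnitAddCircle} (hy : y ∈ X f) : ∃ x ∈ X f, rhoRing g x = y := by
  let I : AddSubgroup (MonoidAlgebra ℤ Γ) := (Ideal.span {f}).toAddSubgroup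
  have hI : ∀ a, a ∈ I ↔ a ∈ Ideal.span {f} := fun a => Iff.rfl
  let m : MonoidAlgebra ℤ Γ ⧸ I →+ MonoidAlgebra ℤ Γ ⧸ I :=
    QuotientAddGroup.map I I (AddMonoidHom.mulRight g) (by
      intro a ha
      rw [AddSubgroup.mem_comap, AddMonoidHom.mulRight_apply, hI, ← (hg a).eq]
      exact Ideal.mul_mem_left _ _ ha)
  have hm : Function.Injective m := by
    rw [injective_iff_map_eq_zero]
    intro q
    induction q using QuotientAddGroup.induction_on with
    | H a =>
      intro h
      rw [QuotientAddGroup.map_mk, QuotientAddGroup.eq_zero_iff] at h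
      exact (QuotientAddGroup.eq_zero_iff a).2 (hinj a h)
  let Y : MonoidAlgebra ℤ Γ ⧸ I →+ UnitAddCircle := QuotientAddGroup.lift I (pairing y) (by
    intro a ha
    obtain ⟨b, rfl⟩ := Ideal.mem_span_singleton'.1 ha
    exact pairing_mul_eq_zero hy b)
  obtain ⟨h, hh⟩ := (Module.Baer.of_divisible UnitAddCircle).extension_property_addMonoidHom m hm Y
  let H : MonoidAlgebra ℤ Γ →+ UnitAddCircle := h.comp (QuotientAddGroup.mk' I)
  let x : Γ → UnitAddCircle := fun γ => H (MonoidAlgebra.single γ 1)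
  have hx : pairing x = H := by
    refine MonoidAlgebra.addMonoidHom_ext fun γ n => ?_
    rw [pairing_single, ← map_zsmul, MonoidAlgebra.smul_single]
    simp
  have hρ : ∀ (p : MonoidAlgebra ℤ Γ) δ, rhoRing p x δ = H (MonoidAlgebra.single δ 1 * p) := by
    intro p δ
    rw [← hx, pairing_single_mul, one_smul]
  refine ⟨x, ?_, ?_⟩
  · refine funext fun δ => ?_
    rw [hρ]
    change h _ = 0
    rw [show QuotientAddGroup.mk' I (MonoidAlgebra.single δ 1 * f) = 0 from
      (QuotientAddGroup.eq_zero_iff _).2 (Ideal.mul_mem_left _ _ (Ideal.mem_span_singleton_self f)),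
      map_zero]
  · refine funext fun δ => ?_
    rw [hρ]
    have := DFunLike.congr_fun hh (QuotientAddGroup.mk' I (MonoidAlgebra.single δ 1))
    refine Eq.trans this ?_
    change pairing y _ = _
    rw [pairing_single, one_smul]

/-! ### Integer codes and specification -/

/-- If `w · f = g` with `w` summable, then every point of `ρ^g X_f` is the reduction mod `1` of
the correlation of `w` with a bounded integer configuration. -/
theorem exists_int_corr_eq {f g : MonoidAlgebra ℤ Γ} {w : Γ → ℝ} (hw : Summable fun γ => |w γ|)
    (hwf : funMul w f = fun δ => (g.coeff δ : ℝ)) {x : Γ → UnitAddCircle} (hx : x ∈ X f) :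
    ∃ h : Γ → ℤ, (∀ γ, |(h γ : ℝ)| ≤ f.coeff.sum fun _ n => |(n : ℝ)|) ∧
      ∀ γ, ((corr w (fun δ => (h δ : ℝ)) γ : ℝ) : UnitAddCircle) = rhoRing g x γ := by
  have hlift : ∀ t : UnitAddCircle, ∃ r : ℝ, |r| ≤ 1 ∧ (r : UnitAddCircle) = t := by
    intro t
    obtain ⟨r, rfl⟩ := QuotientAddGroup.mk_surjective t
    refine ⟨Int.fract r, ?_, ?_⟩
    · rw [abs_of_nonneg (Int.fract_nonneg r)]
      exact (Int.fract_lt_one r).le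
    · rw [← Int.self_sub_floor, AddCircle.coe_sub, sub_eq_self]
      exact (AddCircle.coe_eq_zero_iff 1).2 ⟨⌊r⌋, by simp⟩
  choose v hv1 hv using fun γ => hlift (x γ)
  obtain rfl : (fun γ => (v γ : UnitAddCircle)) = x := funext hv
  have hint : ∀ δ, ∃ n : ℤ, (n : ℝ) = rhoReal f v δ := by
    intro δ
    have h0 : ((rhoReal f v δ : ℝ) : UnitAddCircle) = 0 := by
      rw [coe_rhoReal, show rhoRing f _ = 0 from hx]
      rfl
    obtain ⟨n, hn⟩ := (AddCircle.coe_eq_zero_iff 1).1 h0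
    exact ⟨n, by simpa using hn⟩
  choose h hh using hint
  refine ⟨h, fun γ => ?_, fun γ => ?_⟩
  · rw [hh]
    exact abs_rhoReal_le f hv1 γ
  · simp only [hh]
    rw [show (fun δ => rhoReal f v δ) = rhoReal f v from rfl, corr_rhoReal f hw hv1, hwf,
      corr_coeff, coe_rhoReal]

/-- `ρ^f (w ⋆ h) = ρ^g h` is integer valued. -/
theorem corr_int_mem_X {f g : MonoidAlgebra ℤ Γ} {w : Γ → ℝ} (hw : Summable fun γ => |w γ|)
    (hfw : mulFun f w = fun δ => (g.coeff δ : ℝ)) {h : Γ → ℤ} {C : ℝ}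
    (hC : ∀ γ, |(h γ : ℝ)| ≤ C) :
    (fun γ => ((corr w (fun δ => (h δ : ℝ)) γ : ℝ) : UnitAddCircle)) ∈ X f := by
  refine funext fun δ => ?_
  rw [← coe_rhoReal, rhoReal_corr f hw hC, hfw, corr_coeff]
  refine (AddCircle.coe_eq_zero_iff 1).2 ⟨g.coeff.sum fun γ n => n * h (δ * γ), ?_⟩
  simp [rhoReal, Finsupp.sum]

theorem abs_corr_sub_corr_le {w u v : Γ → ℝ} (hw : Summable fun γ => |w γ|) {C : ℝ}
    (hu : ∀ γ, |u γ| ≤ C) (hv : ∀ γ, |v γ| ≤ C) (K : Finset Γ) (δ : Γ)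
    (huv : ∀ κ ∈ K, u (δ * κ) = v (δ * κ)) :
    |corr w u δ - corr w v δ| ≤ (∑' γ : {γ // γ ∉ K}, |w γ|) * (2 * C) := by
  have h2 : ∀ γ, |u γ - v γ| ≤ 2 * C := fun γ =>
    (abs_sub _ _).trans (by linarith [hu γ, hv γ])
  have hs : Summable fun γ => w γ * (u (δ * γ) - v (δ * γ)) :=
    summable_mul_of_bounded (v := fun γ => u (δ * γ) - v (δ * γ)) hw fun γ => h2 _
  have heq : corr w u δ - corr w v δ =
      ∑' γ : {γ // γ ∉ K}, w γ * (u (δ * γ) - v (δ * γ)) := by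
    rw [corr, corr, ← Summable.tsum_sub
      (summable_mul_of_bounded (v := fun γ => u (δ * γ)) hw fun γ => hu _)
      (summable_mul_of_bounded (v := fun γ => v (δ * γ)) hw fun γ => hv _)]
    simp only [← mul_sub]
    rw [← hs.sum_add_tsum_subtype_compl K, Finset.sum_eq_zero, zero_add]
    intro κ hκ
    rw [huv κ hκ, sub_self, mul_zero]
  rw [heq, ← tsum_mul_right]
  have hs' : Summable fun γ : {γ // γ ∉ K} => |w γ| * (2 * C) :=
    (hw.subtype _).mul_right _
  refine tsum_of_norm_bounded (f := fun γ : {γ // γ ∉ K} => w γ * (u (δ * γ) - v (δ * γ)))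
    hs'.hasSum fun γ => ?_
  rw [Real.norm_eq_abs, abs_mul]
  exact mul_le_mul_of_nonneg_left (h2 _) (abs_nonneg _)

theorem norm_coe_le_abs (r : ℝ) : ‖(r : UnitAddCircle)‖ ≤ |r| :=
  QuotientAddGroup.norm_mk_le_norm

/-- The specification property of `X_f`, given a summable `w` with `f · w = w · f = g` such that
`ρ^g` maps `X_f` onto itself. -/
theorem exists_specification {f g : MonoidAlgebra ℤ Γ} {w : Γ → ℝ}
    (hw : Summable fun γ => |w γ|)
    (hfw : mulFun f w = fun δ => (g.coeff δ : ℝ)) (hwf : funMul w f = fun δ => (g.coeff δ : ℝ))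
    (hsurj : ∀ y ∈ X f, ∃ x ∈ X f, rhoRing g x = y) {ε : ℝ} (hε : 0 < ε) :
    ∃ Fε : Finset Γ, Fε.Nonempty ∧
      ∀ F₁ F₂ : Set Γ, (F₁ * (Fε : Set Γ)) ∩ (F₂ * (Fε : Set Γ)) = ∅ →
        ∀ x₁ ∈ X f, ∀ x₂ ∈ X f, ∃ y ∈ X f,
          (∀ γ ∈ F₁, ‖x₁ γ - y γ‖ < ε) ∧ (∀ γ ∈ F₂, ‖x₂ γ - y γ‖ < ε) := by
  classical
  set C : ℝ := f.coeff.sum fun _ n => |(n : ℝ)| with hCdef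
  have hC0 : 0 ≤ C := Finset.sum_nonneg fun _ _ => abs_nonneg _
  have hlim : Filter.Tendsto (fun K : Finset Γ => (∑' γ : {γ // γ ∉ K}, |w γ|) * (2 * C))
      Filter.atTop (nhds 0) := by
    simpa using (tendsto_tsum_compl_atTop_zero fun γ => |w γ|).mul_const (2 * C)
  obtain ⟨K, hK1, hK⟩ := ((Filter.eventually_ge_atTop {(1 : Γ)}).and
    (hlim.eventually (gt_mem_nhds hε))).exists
  have hrep : ∀ x ∈ X f, ∃ h : Γ → ℤ, (∀ γ, |(h γ : ℝ)| ≤ C) ∧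
      ∀ γ, ((corr w (fun δ => (h δ : ℝ)) γ : ℝ) : UnitAddCircle) = x γ := by
    intro x hx
    obtain ⟨z, hz, rfl⟩ := hsurj x hx
    exact exists_int_corr_eq hw hwf hz
  refine ⟨K, ⟨1, hK1 (Finset.mem_singleton_self 1)⟩, fun F₁ F₂ hF x₁ hx₁ x₂ hx₂ => ?_⟩
  obtain ⟨h₁, hb₁, he₁⟩ := hrep x₁ hx₁
  obtain ⟨h₂, hb₂, he₂⟩ := hrep x₂ hx₂
  -- Splice the two codes; both obey the bound `C`, so the result does too.
  let h : Γ → ℤ := (F₁ * (K : Set Γ)).piecewise h₁ h₂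
  have hb : ∀ γ, |(h γ : ℝ)| ≤ C := by
    intro γ
    by_cases hγ : γ ∈ F₁ * (K : Set Γ)
    · simpa [h, hγ] using hb₁ γ
    · simpa [h, hγ] using hb₂ γ
  refine ⟨_, corr_int_mem_X hw hfw hb, fun γ hγ => ?_, fun γ hγ => ?_⟩
  · rw [← he₁ γ, ← AddCircle.coe_sub]
    refine ((norm_coe_le_abs _).trans (abs_corr_sub_corr_le hw hb₁ hb K γ ?_)).trans_lt hK
    intro κ hκ
    simp only [h]
    rw [Set.piecewise_eq_of_mem _ _ _ (Set.mul_mem_mul hγ (Finset.mem_coe.2 hκ))]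
  · rw [← he₂ γ, ← AddCircle.coe_sub]
    refine ((norm_coe_le_abs _).trans (abs_corr_sub_corr_le hw hb₂ hb K γ ?_)).trans_lt hK
    intro κ hκ
    simp only [h]
    rw [Set.piecewise_eq_of_notMem]
    intro hmem
    -- Disjointness keeps `F₂K` in the region coded by `h₂`.
    exact (Set.eq_empty_iff_forall_notMem.1 hF) _
      ⟨hmem, Set.mul_mem_mul hγ (Finset.mem_coe.2 hκ)⟩

end PrincipalAction

/-! ### `ℤ[ℍ]` as a twisted Laurent polynomial ring over `ℤ[z, z⁻¹]` -/

namespace Heisenberg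

open LaurentPolynomial

/-- The matrix with superdiagonal `(a, b)` and upper right entry `c`. -/
def mk (a b c : ℤ) : heisenberg :=
  ⟨⟨!![1, a, c; 0, 1, b; 0, 0, 1], by simp [Matrix.det_fin_three]⟩, by
    refine ⟨?_, ?_, ?_, ?_, ?_, ?_⟩ <;> simp⟩

/-- The image of an element in the abelianization `ℤ × ℤ`. -/
def ab (γ : heisenberg) : ℤ × ℤ := (γ.1.1 0 1, γ.1.1 1 2)

/-- The upper right entry. -/
def corner (γ : heisenberg) : ℤ := γ.1.1 0 2

@[ext] theorem ext {γ δ : heisenberg} (h : ab γ = ab δ) (h' : corner γ = corner δ) : γ = δ := by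
  obtain ⟨h1, h2⟩ := Prod.ext_iff.1 h
  obtain ⟨⟨M, hM⟩, a1, a2, a3, a4, a5, a6⟩ := γ
  obtain ⟨⟨N, hN⟩, b1, b2, b3, b4, b5, b6⟩ := δ
  simp only [ab, corner] at a1 a2 a3 a4 a5 a6 b1 b2 b3 b4 b5 b6 h1 h2 h'
  refine Subtype.ext (Subtype.ext (Matrix.ext fun i j => ?_))
  fin_cases i <;> fin_cases j <;> simp [*]

@[simp] theorem ab_mk (a b c : ℤ) : ab (mk a b c) = (a, b) := by simp [ab, mk]

@[simp] theorem corner_mk (a b c : ℤ) : corner (mk a b c) = c := by simp [corner, mk]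

theorem coe_mul_apply (γ δ : heisenberg) (i j : Fin 3) :
    (γ * δ).1.1 i j = ∑ k, γ.1.1 i k * δ.1.1 k j :=
  Matrix.mul_apply

@[simp] theorem ab_mul (γ δ : heisenberg) : ab (γ * δ) = ab γ + ab δ := by
  obtain ⟨h1, h2, -, h4, -, -⟩ := γ.2
  obtain ⟨-, k2, k3, -, -, k6⟩ := δ.2
  refine Prod.ext ?_ ?_
  · simp only [ab, coe_mul_apply, Fin.sum_univ_three, Prod.fst_add, h1, k2, k6]
    ring
  · simp only [ab, coe_mul_apply, Fin.sum_univ_three, Prod.snd_add, h2, h4, k3]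
    ring

@[simp] theorem corner_mul (γ δ : heisenberg) :
    corner (γ * δ) = corner γ + corner δ + (ab γ).1 * (ab δ).2 := by
  simp only [ab, corner, coe_mul_apply, Fin.sum_univ_three, γ.2.1, δ.2.2.2.1]
  ring

@[simp] theorem ab_one : ab 1 = 0 := by simp [ab]

@[simp] theorem corner_one : corner 1 = 0 := by simp [corner]

/-- The embedding of `ℤ[z, z⁻¹]` into `ℤ[ℍ]` that sends `z` to the generator of the center. -/
noncomputable def ofLaurent : ℤ[T;T⁻¹] →ₐ[ℤ] MonoidAlgebra ℤ heisenberg :=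
  AddMonoidAlgebra.lift ℤ (MonoidAlgebra ℤ heisenberg) ℤ
    { toFun := fun k => MonoidAlgebra.single (mk 0 0 k.toAdd) 1
      map_one' := by
        rw [MonoidAlgebra.one_def]
        congr 1
        ext <;> simp
      map_mul' := fun k l => by
        rw [MonoidAlgebra.single_mul_single, mul_one]
        congr 1
        ext <;> simp }

@[simp] theorem ofLaurent_single (k n : ℤ) :
    ofLaurent (.single k n) = MonoidAlgebra.single (mk 0 0 k) n := by
  rw [ofLaurent, AddMonoidAlgebra.lift_single]
  simp

/-- The coefficients of an element of `ℤ[ℍ]` with respect to its basis over `ℤ[z, z⁻¹]`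
that is indexed by the abelianization. -/
noncomputable def coords : MonoidAlgebra ℤ heisenberg →+ (ℤ × ℤ →₀ ℤ[T;T⁻¹]) :=
  (Finsupp.liftAddHom fun γ => (Finsupp.singleAddHom (ab γ)).comp
    (AddMonoidAlgebra.singleAddHom (corner γ))).comp
    MonoidAlgebra.coeffAddEquiv.toAddMonoidHom

@[simp] theorem coords_single (γ : heisenberg) (n : ℤ) :
    coords (.single γ n) = Finsupp.single (ab γ) (.single (corner γ) n) := by
  simp [coords]

/-- The inverse of `coords`. -/
noncomputable def ofCoords : (ℤ × ℤ →₀ ℤ[T;T⁻¹]) →+ MonoidAlgebra ℤ heisenberg :=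
  Finsupp.liftAddHom fun m =>
    (AddMonoidHom.mulRight (MonoidAlgebra.single (mk m.1 m.2 0) 1)).comp
      (ofLaurent : ℤ[T;T⁻¹] →+ MonoidAlgebra ℤ heisenberg)

theorem ofCoords_single (m : ℤ × ℤ) (p : ℤ[T;T⁻¹]) :
    ofCoords (.single m p) = ofLaurent p * MonoidAlgebra.single (mk m.1 m.2 0) 1 := by
  simp [ofCoords]

theorem ofCoords_coords (u : MonoidAlgebra ℤ heisenberg) : ofCoords (coords u) = u := by
  induction u using MonoidAlgebra.induction_linear with
  | zero => simp
  | add a b ha hb => rw [map_add, map_add, ha, hb]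
  | single γ n =>
    rw [coords_single, ofCoords_single, ofLaurent_single, MonoidAlgebra.single_mul_single, mul_one]
    congr 1
    ext <;> simp

theorem coords_injective : Function.Injective coords :=
  Function.LeftInverse.injective ofCoords_coords

theorem ofCoords_smul (p : ℤ[T;T⁻¹]) (w : ℤ × ℤ →₀ ℤ[T;T⁻¹]) :
    ofCoords (p • w) = ofLaurent p * ofCoords w := by
  induction w using Finsupp.induction_linear with
  | zero => simp
  | add a b ha hb => rw [smul_add, map_add, map_add, ha, hb, mul_add]
  | single m q => rw [Finsupp.smul_single, ofCoords_single, ofCoords_single, smul_eq_mul, map_mul,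
      mul_assoc]

/-- The twist `T (i.1 * j.2)` is the cocycle in `corner_mul`. -/
theorem coords_mul (u v : MonoidAlgebra ℤ heisenberg) :
    coords (u * v) = (coords u).sum fun i p => (coords v).sum fun j q =>
      Finsupp.single (i + j) (p * q * T (i.1 * j.2)) := by
  induction u using MonoidAlgebra.induction_linear with
  | zero => simp
  | add a b ha hb =>
    rw [add_mul, map_add, map_add, ha, hb, Finsupp.sum_add_index']
    · simp
    · intro i p q
      rw [← Finsupp.sum_add]
      simp only [add_mul, Finsupp.single_add]
  | single γ n =>
    induction v using MonoidAlgebra.induction_linear with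
    | zero => simp
    | add a b ha hb =>
      rw [mul_add, map_add, map_add, ha, hb, ← Finsupp.sum_add]
      refine Finset.sum_congr rfl fun i _ => ?_
      dsimp only
      rw [Finsupp.sum_add_index']
      · simp
      · intro j p q
        simp only [mul_add, add_mul, Finsupp.single_add]
    | single δ k =>
      rw [MonoidAlgebra.single_mul_single, coords_single, coords_single, coords_single,
        Finsupp.sum_single_index, Finsupp.sum_single_index, ab_mul, corner_mul, T,
        AddMonoidAlgebra.single_mul_single, AddMonoidAlgebra.single_mul_single, mul_one]
      · simp
      · simp

theorem coords_ofLaurent (p : ℤ[T;T⁻¹]) : coords (ofLaurent p) = Finsupp.single 0 p := by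
  induction p using AddMonoidAlgebra.induction_linear with
  | zero => simp
  | add a b ha hb => rw [map_add, map_add, ha, hb, Finsupp.single_add]
  | single k n => rw [ofLaurent_single, coords_single, ab_mk, corner_mk, Prod.mk_zero_zero]

theorem coords_ofLaurent_mul (p : ℤ[T;T⁻¹]) (u : MonoidAlgebra ℤ heisenberg) :
    coords (ofLaurent p * u) = p • coords u := by
  rw [coords_mul, coords_ofLaurent, Finsupp.sum_single_index (by simp)]
  conv_rhs => rw [← Finsupp.sum_single (coords u), Finsupp.smul_sum]
  refine Finset.sum_congr rfl fun j _ => ?_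
  simp

theorem ofLaurent_mul_cancel {p : ℤ[T;T⁻¹]} (hp : p ≠ 0) {u v : MonoidAlgebra ℤ heisenberg}
    (h : ofLaurent p * u = ofLaurent p * v) : u = v := by
  have h' := congrArg coords h
  rw [coords_ofLaurent_mul, coords_ofLaurent_mul] at h'
  refine coords_injective (Finsupp.ext fun m => mul_left_cancel₀ hp ?_)
  simpa using DFunLike.congr_fun h' m

theorem commute_ofLaurent (p : ℤ[T;T⁻¹]) (u : MonoidAlgebra ℤ heisenberg) :
    Commute (ofLaurent p) u := by
  induction p using AddMonoidAlgebra.induction_linear with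
  | zero => simp
  | add a b ha hb => rw [map_add]; exact ha.add_left hb
  | single k n =>
    rw [ofLaurent_single]
    refine MonoidAlgebra.single_commute (fun γ => ?_) (fun _ => Commute.all _ _) u
    ext <;> simp [add_comm]

/-! ### Divisibility by primes of `ℤ[z, z⁻¹]` -/

theorem dvd_of_forall_dvd_coords {p : ℤ[T;T⁻¹]} {u : MonoidAlgebra ℤ heisenberg}
    (h : ∀ m, p ∣ coords u m) : ∃ v, u = ofLaurent p * v := by
  choose q hq using h
  refine ⟨ofCoords (∑ m ∈ (coords u).support, Finsupp.single m (q m)), ?_⟩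
  rw [← ofCoords_smul, Finset.smul_sum]
  conv_lhs => rw [← ofCoords_coords u, ← Finsupp.sum_single (coords u), Finsupp.sum]
  simp only [Finsupp.smul_single, smul_eq_mul, ← hq]

/-- A prime of `ℤ[z, z⁻¹]` is completely prime in `ℤ[ℍ]`. -/
theorem forall_dvd_coords_of_dvd_mul {p : ℤ[T;T⁻¹]} (hp : Prime p)
    {u v : MonoidAlgebra ℤ heisenberg} (h : ∀ m, p ∣ coords (u * v) m) :
    (∀ m, p ∣ coords u m) ∨ ∀ m, p ∣ coords v m := by
  classical
  by_contra! ⟨⟨m₀, hm₀⟩, n₀, hn₀⟩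
  let A := (coords u).support.filter fun m => ¬ p ∣ coords u m
  let B := (coords v).support.filter fun m => ¬ p ∣ coords v m
  have hmem : ∀ (w : ℤ × ℤ →₀ ℤ[T;T⁻¹]) m,
      m ∈ w.support.filter (fun m => ¬ p ∣ w m) ↔ ¬ p ∣ w m := by
    intro w m
    rw [Finset.mem_filter, and_iff_right_iff_imp, Finsupp.mem_support_iff]
    intro hm h0
    exact hm (h0 ▸ dvd_zero p)
  -- `ℤ × ℤ` has unique sums, so at `i + j` exactly one product of coefficients, up to a unit,
  -- escapes `p`.
  obtain ⟨i, hi, j, hj, hij⟩ := UniqueSums.uniqueAdd_of_nonempty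
    (A := A) (B := B) ⟨m₀, (hmem _ _).2 hm₀⟩ ⟨n₀, (hmem _ _).2 hn₀⟩
  have hi' := (hmem _ _).1 hi
  have hj' := (hmem _ _).1 hj
  have hsum : coords (u * v) (i + j) = ∑ x ∈ (coords u).support ×ˢ (coords v).support,
      if x.1 + x.2 = i + j then coords u x.1 * coords v x.2 * T (x.1.1 * x.2.2) else 0 := by
    rw [coords_mul, Finset.sum_product]
    simp only [Finsupp.sum, Finsupp.finsetSum_apply, Finsupp.single_apply]
  have hx : (i, j) ∈ (coords u).support ×ˢ (coords v).support :=
    Finset.mem_product.2 ⟨(Finset.mem_filter.1 hi).1, (Finset.mem_filter.1 hj).1⟩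
  have hd := h (i + j)
  rw [hsum, ← Finset.add_sum_erase _ _ hx, if_pos rfl, dvd_add_left] at hd
  · rcases hp.dvd_or_dvd hd with hd | hd
    · exact (hp.dvd_or_dvd hd).elim hi' hj'
    · exact hp.not_isUnit (isUnit_of_dvd_unit hd (isUnit_T _))
  · refine Finset.dvd_sum fun x hx => ?_
    split_ifs with hxe
    · by_cases h1 : p ∣ coords u x.1
      · exact (h1.mul_right _).mul_right _
      by_cases h2 : p ∣ coords v x.2
      · exact (h2.mul_left _).mul_right _
      obtain ⟨e1, e2⟩ := hij ((hmem _ _).2 h1) ((hmem _ _).2 h2) hxe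
      exact absurd (Prod.ext e1 e2) (Finset.ne_of_mem_erase hx)
    · exact dvd_zero p

theorem dvd_or_dvd_of_prime {p : ℤ[T;T⁻¹]} (hp : Prime p) {u v w : MonoidAlgebra ℤ heisenberg}
    (h : u * v = ofLaurent p * w) :
    (∃ u', u = ofLaurent p * u') ∨ ∃ v', v = ofLaurent p * v' := by
  refine (forall_dvd_coords_of_dvd_mul hp fun m => ?_).imp
    dvd_of_forall_dvd_coords dvd_of_forall_dvd_coords
  rw [h, coords_ofLaurent_mul]
  exact ⟨coords w m, rfl⟩

theorem not_isUnit_ofLaurent {p : ℤ[T;T⁻¹]} (hp : ¬ IsUnit p) : ¬ IsUnit (ofLaurent p) := by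
  intro h
  obtain ⟨v, hv⟩ := h.exists_right_inv
  have h1 := congrArg (fun w => coords w 0) hv
  simp only [coords_ofLaurent_mul, ← map_one ofLaurent, coords_ofLaurent, Finsupp.smul_apply,
    Finsupp.single_eq_same, smul_eq_mul] at h1
  exact hp (IsUnit.of_mul_eq_one _ h1)

instance : UniqueFactorizationMonoid ℤ[T;T⁻¹] :=
  UniqueFactorizationMonoid.of_isLocalization (Submonoid.powers (Polynomial.X : Polynomial ℤ)) _

/-- Right multiplication by a central element outside `ℤ[ℍ] f` is injective modulo `ℤ[ℍ] f`
when `f` is irreducible. -/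
theorem mem_span_of_mul_ofLaurent_mem {f : MonoidAlgebra ℤ heisenberg} (hf : Irreducible f)
    (p : ℤ[T;T⁻¹]) (hp : ofLaurent p ∉ Ideal.span {f}) (a : MonoidAlgebra ℤ heisenberg)
    (ha : a * ofLaurent p ∈ Ideal.span {f}) : a ∈ Ideal.span {f} := by
  induction p using UniqueFactorizationMonoid.induction_on_prime generalizing a with
  | h₁ => exact absurd (by simp) hp
  | h₂ p hu =>
    rw [← (commute_ofLaurent p a).eq] at ha
    obtain ⟨b, hb⟩ := (hu.map ofLaurent).exists_left_inv
    simpa [← mul_assoc, hb] using Ideal.mul_mem_left _ b ha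
  | h₃ q p _ hprime ih =>
    obtain ⟨b, hb⟩ := Ideal.mem_span_singleton'.1 ha
    rw [map_mul, ← mul_assoc, ← (commute_ofLaurent p a).eq, mul_assoc] at hb
    rcases dvd_or_dvd_of_prime hprime hb with ⟨b', rfl⟩ | ⟨f', hf'⟩
    · rw [mul_assoc] at hb
      refine ih (fun hq => hp ?_) a
        (Ideal.mem_span_singleton'.2 ⟨b', ofLaurent_mul_cancel hprime.ne_zero hb⟩)
      rw [map_mul]
      exact Ideal.mul_mem_left _ _ hq
    -- Here `f = p f'` with `f'` a unit, so `ℤ[ℍ]f` contains `p` and hence `p q`.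
    · have hu : IsUnit f' :=
        (hf.isUnit_or_isUnit hf').resolve_left (not_isUnit_ofLaurent hprime.not_isUnit)
      obtain ⟨c, hc⟩ := hu.exists_left_inv
      refine absurd (Ideal.mem_span_singleton'.2 ⟨ofLaurent q * c, ?_⟩) hp
      rw [hf', (commute_ofLaurent p f').eq, mul_assoc, ← mul_assoc c, hc, one_mul, ← map_mul,
        mul_comm]

/-! ### The center of `ℤ[ℍ]` -/

theorem coeff_eq_of_mul_eq_mul {g : MonoidAlgebra ℤ heisenberg}
    (hg : g ∈ Subring.center (MonoidAlgebra ℤ heisenberg)) {σ γ δ : heisenberg}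
    (h : δ * σ = σ * γ) : g.coeff δ = g.coeff γ := by
  have hcomm := congrArg (fun u => u.coeff (σ * γ))
    (Subring.mem_center_iff.1 hg (MonoidAlgebra.single σ 1))
  rw [MonoidAlgebra.coeff_single_mul_eq_mul_coeff γ (by simp),
    MonoidAlgebra.coeff_mul_single_eq_coeff_mul δ (by simp [← h])] at hcomm
  simpa using hcomm.symm

/-- Central elements have coefficients constant on conjugacy classes, and noncentral classes are
infinite. -/
theorem ab_eq_zero_of_mem_support {g : MonoidAlgebra ℤ heisenberg}
    (hg : g ∈ Subring.center (MonoidAlgebra ℤ heisenberg)) {γ : heisenberg}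
    (hγ : g.coeff γ ≠ 0) : ab γ = 0 := by
  by_contra hne
  have hmem : ∀ k : ℤ, g.coeff (mk (ab γ).1 (ab γ).2
      (corner γ + k * ((ab γ).1 * (ab γ).1 + (ab γ).2 * (ab γ).2))) ≠ 0 := by
    intro k
    -- With `ab γ = (a, b)`, conjugation by this `σ` adds `k(a² + b²)` to the corner.
    rwa [coeff_eq_of_mul_eq_mul hg (σ := mk (k * (ab γ).2) (-(k * (ab γ).1)) 0) (γ := γ)]
    ext
    · simp [add_comm]
    · simp [add_comm]
    · simp
      ring
  have hpos : (ab γ).1 * (ab γ).1 + (ab γ).2 * (ab γ).2 ≠ 0 := by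
    intro h0
    obtain ⟨h1, h2⟩ := (mul_self_add_mul_self_eq_zero).1 h0
    exact hne (Prod.ext h1 h2)
  refine Set.infinite_of_injective_forall_mem (f := fun k : ℤ => mk (ab γ).1 (ab γ).2
    (corner γ + k * ((ab γ).1 * (ab γ).1 + (ab γ).2 * (ab γ).2))) ?_
    (fun k => Finsupp.mem_support_iff.2 (hmem k)) g.coeff.support.finite_toSet
  intro k l hkl
  have := congrArg corner hkl
  simpa [hpos] using this

theorem exists_ofLaurent_eq_of_mem_center {g : MonoidAlgebra ℤ heisenberg}
    (hg : g ∈ Subring.center (MonoidAlgebra ℤ heisenberg)) : ∃ p, ofLaurent p = g := by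
  refine ⟨∑ γ ∈ g.coeff.support, .single (corner γ) (g.coeff γ), ?_⟩
  rw [map_sum]
  conv_rhs => rw [← MonoidAlgebra.sum_coeff_single g, Finsupp.sum]
  refine Finset.sum_congr rfl fun γ hγ => ?_
  rw [ofLaurent_single]
  congr 1
  ext <;> simp [ab_eq_zero_of_mem_support hg (Finsupp.mem_support_iff.1 hγ)]

end Heisenberg

theorem theorem5p2
    (f : MonoidAlgebra ℤ heisenberg) (hf : Irreducible f)
    (fsharp : heisenberg → ℝ) (hfsharp : PrincipalAction.IsFormalInverse f fsharp)
    (g : MonoidAlgebra ℤ heisenberg)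
    (hgc : g ∈ Subring.center (MonoidAlgebra ℤ heisenberg))
    -- `Ideal.span {f}` is the left ideal `ℤ[ℍ] f`
    (hgf : g ∉ Ideal.span {f})
    (hgs : Memℓp (PrincipalAction.funMul fsharp g) 1)
    (ε : ℝ) (hε : 0 < ε) :
    ∃ Fε : Finset heisenberg, Fε.Nonempty ∧
      ∀ F₁ F₂ : Set heisenberg,
        (F₁ * (Fε : Set heisenberg)) ∩ (F₂ * (Fε : Set heisenberg)) = ∅ →
        ∀ x₁ ∈ PrincipalAction.X f, ∀ x₂ ∈ PrincipalAction.X f,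
          ∃ y ∈ PrincipalAction.X f,
            (∀ γ ∈ F₁, ‖x₁ γ - y γ‖ < ε) ∧ (∀ γ ∈ F₂, ‖x₂ γ - y γ‖ < ε) := by
  have hcomm : ∀ a, Commute g a := fun a => (Subring.mem_center_iff.1 hgc a).symm
  refine PrincipalAction.exists_specification (g := g)
    (w := PrincipalAction.funMul fsharp g) ?_ ?_ ?_ ?_ hε
  · have := hgs.summable (by norm_num)
    simpa using this
  · rw [PrincipalAction.mulFun_funMul, hfsharp.1, PrincipalAction.funMul_single_one]
  -- Centrality gives `f^♯ · g · f = f^♯ · f · g`.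
  · rw [PrincipalAction.funMul_funMul, (hcomm f).eq, ← PrincipalAction.funMul_funMul, hfsharp.2,
      PrincipalAction.funMul_single_one]
  · intro y hy
    refine PrincipalAction.exists_rhoRing_eq hcomm ?_ hy
    obtain ⟨p, rfl⟩ := Heisenberg.exists_ofLaurent_eq_of_mem_center hgc
    exact Heisenberg.mem_span_of_mul_ofLaurent_mem hf p hgf
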